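/- Consider the square lattice with vertex set $V=\mathbb Z^2$, edge set $E$ (pairs of nearest neighbours) and set $\tilde V$ of faces (unit squares); the dual lattice has vertex set $\tilde V$, and its edges join faces sharing an edge $e\in E$, each dual edge crossing exactly that $e$. For finite $\Lambda\subset E$ let $\mathcal A_\Lambda=\mathbb B\big(\bigotimes_{e\in\Lambda}\mathbb C^2\big)$, let $\mathcal A_{\rm loc}=\bigcup_\Lambda\mathcal A_\Lambda$ be the union along the inclusions $a\mapsto a\otimes 1$, and let $\mathcal A$ be the $C^*$-algebra obtained by completing $\mathcal A_{\rm loc}$ in the operator norm. Write $\sigma^x_e,\sigma^z_e\in\mathcal A$ for the Pauli matrices at the edge $e$, and define the star and face operators $$A_v=\prod_{e\ni v}\sigma^x_e\quad(v\in V),\qquad B_{\tilde v}=\prod_{e\in\partial\tilde v}\sigma^z_e\quad(\tilde v\in\tilde V),$$ and let $\mathcal C=C^*\{A_v,B_{\tilde v} \mid v\in V,\ \tilde v\in\tilde V\}\subseteq\mathcal A$. The ribbon operators are $$F^z_\rho=\prod_{e\in\rho}\sigma^z_e,\qquad F^x_{\tilde\rho}=\prod_{e\cap\tilde\rho\neq\emptyset}\sigma^x_e,$$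 where $\rho$ and $\tilde\rho$ run over the finite open non-self-intersecting paths, with at least one edge, on the lattice and on the dual lattice, respectively. For a $C^*$-subalgebra $\mathcal B\subseteq\mathcal A$, call $\mathcal B$ a masa if its relative commutant in $\mathcal A$ is $\mathcal B$ itself; call $a\in\mathcal A$ a normalizer of $\mathcal B$ if $a\mathcal Ba^*\cup a^*\mathcal Ba\subseteq\mathcal B$; and call a masa regular if its normalizers generate $\mathcal A$ as a $C^*$-algebra. **Proposition 3.2 (regular masa).** $\mathcal C$ is a regular masa of $\mathcal A$. Moreover, every ribbon operator is a normalizer of $\mathcal C$, and the ribbon operators generate $\mathcal A$ as a $C^*$-algebra. -/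

import Mathlib

open scoped Matrix.Norms.L2Operator Kronecker

namespace ToricCode

/-! ### The square lattice and its dual -/

/-- Vertices of the square lattice: the points of `ℤ²`. -/
abbrev Vertex : Type := ℤ × ℤ

/-- Faces of the square lattice (the vertices of the dual lattice): the face `(x, y)` is the unit
square `[x, x + 1] × [y, y + 1]`. -/
abbrev Face : Type := ℤ × ℤ

/-- Unoriented edges of the square lattice: `((x, y), false)` is the horizontal edge joining
`(x, y)` to `(x + 1, y)`, and `((x, y), true)` is the vertical edge joining `(x, y)` to
`(x, y + 1)`. -/
abbrev Edge : Type := (ℤ × ℤ) × Bool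

/-- The two end vertices of an edge. -/
def endVertices : Edge → Sym2 Vertex
  | ((x, y), false) => s((x, y), (x + 1, y))
  | ((x, y), true) => s((x, y), (x, y + 1))

/-- The two faces that have a given edge in their boundary. The dual edge that crosses `e`
transversally joins (the centres of) these two faces, so dual edges are indexed by the edges they
cross, and `sideFaces e` is the pair of ends of the dual edge crossing `e`. -/
def sideFaces : Edge → Sym2 Face
  | ((x, y), false) => s((x, y - 1), (x, y))
  | ((x, y), true) => s((x - 1, y), (x, y))

/-- The edges meeting at a vertex. -/
def starEdges (v : Vertex) : List Edge :=
  [((v.1, v.2), false), ((v.1, v.2), true), ((v.1 - 1, v.2), false), ((v.1, v.2 - 1), true)]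

/-- The edges in the boundary of a face. -/
def faceEdges (p : Face) : List Edge :=
  [((p.1, p.2), false), ((p.1 + 1, p.2), true), ((p.1, p.2 + 1), false), ((p.1, p.2), true)]

theorem mem_starEdges (v : Vertex) (e : Edge) : e ∈ starEdges v ↔ v ∈ endVertices e := by
  obtain ⟨a, b⟩ := v
  obtain ⟨⟨x, y⟩, _ | _⟩ := e <;> simp [starEdges, endVertices] <;> omega

theorem mem_faceEdges (p : Face) (e : Edge) : e ∈ faceEdges p ↔ p ∈ sideFaces e := by
  obtain ⟨a, b⟩ := p
  obtain ⟨⟨x, y⟩, _ | _⟩ := e <;> simp [faceEdges, sideFaces] <;> omega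

theorem nodup_starEdges (v : Vertex) : (starEdges v).Nodup := by
  obtain ⟨a, b⟩ := v
  simp [starEdges]
  omega

theorem nodup_faceEdges (p : Face) : (faceEdges p).Nodup := by
  obtain ⟨a, b⟩ := p
  simp [faceEdges]

/-- A finite, open, non self-intersecting path in the graph with vertex set `W`, edge set `Edge`
and end map `ends`: pairwise distinct vertices `v₀, …, vₙ`, `n ≥ 1`, and for each `i < n` an edge
joining `vᵢ` to `vᵢ₊₁`. With `ends = endVertices` this is a path on the lattice; with
`ends = sideFaces` it is a path on the dual lattice, given by the edges that it crosses. -/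
structure OpenPath {W : Type} (ends : Edge → Sym2 W) where
  length : ℕ
  length_pos : 0 < length
  vertex : Fin (length + 1) → W
  edge : Fin length → Edge
  injective : Function.Injective vertex
  joins : ∀ i : Fin length, ends (edge i) = s(vertex i.castSucc, vertex i.succ)

/-! ### The local algebras -/

/-- `𝒜_Λ = 𝔹(⨂_{e ∈ Λ} ℂ²)`, as matrices indexed by the product basis of `⨂_{e ∈ Λ} ℂ²`, that is
by the configurations `Λ → Fin 2`. The norm is the operator norm for the Hilbert space norm, the
star is the conjugate transpose. -/
abbrev LocalAlgebra (Λ : Finset Edge) : Type := Matrix (Λ → Fin 2) (Λ → Fin 2) ℂ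

/-- For `Λ ⊆ Λ'`, a configuration on `Λ'` is one on `Λ` together with one on `Λ' \ Λ`. -/
def splitConfig {Λ Λ' : Finset Edge} (h : Λ ≤ Λ') :
    (Λ' → Fin 2) ≃ (Λ → Fin 2) × ({e : Λ' // e.1 ∉ Λ} → Fin 2) where
  toFun s := (fun e => s ⟨e.1, h e.2⟩, fun e => s e.1)
  invFun p e := if he : e.1 ∈ Λ then p.1 ⟨e.1, he⟩ else p.2 ⟨e, he⟩
  left_inv s := by
    funext e
    by_cases he : e.1 ∈ Λ <;> simp [he]
  right_inv p := by
    ext e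
    · simp
    · simp [e.2]

/-- The natural inclusion `𝒜_Λ → 𝒜_Λ'`, `a ↦ a ⊗ 1`, for `Λ ⊆ Λ'`. -/
def localInclusion (Λ Λ' : Finset Edge) (h : Λ ≤ Λ') :
    LocalAlgebra Λ →⋆ₐ[ℂ] LocalAlgebra Λ' where
  toFun a := (a ⊗ₖ (1 : Matrix ({e : Λ' // e.1 ∉ Λ} → Fin 2) ({e : Λ' // e.1 ∉ Λ} → Fin 2) ℂ)).submatrix
    (splitConfig h) (splitConfig h)
  map_one' := by simp
  map_mul' a b := by
    rw [Matrix.submatrix_mul_equiv, ← Matrix.mul_kronecker_mul, one_mul]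
  map_zero' := by simp
  map_add' a b := by rw [Matrix.add_kronecker]; rfl
  commutes' r := by
    simp only [Algebra.algebraMap_eq_smul_one, Matrix.smul_kronecker, Matrix.one_kronecker_one,
      Matrix.submatrix_smul, Pi.smul_apply, Matrix.submatrix_one_equiv]
  map_star' a := by
    simp only [Matrix.star_eq_conjTranspose, Matrix.conjTranspose_submatrix,
      Matrix.conjTranspose_kronecker, Matrix.conjTranspose_one]

theorem localInclusion_apply {Λ Λ' : Finset Edge} (h : Λ ≤ Λ') (a : LocalAlgebra Λ)
    (s t : Λ' → Fin 2) :
    localInclusion Λ Λ' h a s t =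
      if ∀ e : Λ', e.1 ∉ Λ → s e = t e then
        a (fun e => s ⟨e.1, h e.2⟩) (fun e => t ⟨e.1, h e.2⟩) else 0 := by
  have hmul : localInclusion Λ Λ' h a s t = a (splitConfig h s).1 (splitConfig h t).1 *
      (1 : Matrix ({e : Λ' // e.1 ∉ Λ} → Fin 2) ({e : Λ' // e.1 ∉ Λ} → Fin 2) ℂ)
        (splitConfig h s).2 (splitConfig h t).2 := rfl
  rw [hmul, Matrix.one_apply]
  have key : (splitConfig h s).2 = (splitConfig h t).2 ↔ ∀ e : Λ', e.1 ∉ Λ → s e = t e := by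
    rw [funext_iff, Subtype.forall]
    rfl
  by_cases hst : ∀ e : Λ', e.1 ∉ Λ → s e = t e
  · rw [if_pos (key.2 hst), if_pos hst, mul_one]
    rfl
  · rw [if_neg (fun h' => hst (key.1 h')), if_neg hst, mul_zero]

theorem localInclusion_injective (Λ Λ' : Finset Edge) (h : Λ ≤ Λ') :
    Function.Injective (localInclusion Λ Λ' h) := by
  intro a b hab
  ext s t
  have := congrFun (congrFun hab ((splitConfig h).symm (s, 0))) ((splitConfig h).symm (t, 0))
  simpa [localInclusion] using this

theorem norm_localInclusion (Λ Λ' : Finset Edge) (h : Λ ≤ Λ') (a : LocalAlgebra Λ) :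
    ‖localInclusion Λ Λ' h a‖ = ‖a‖ :=
  NonUnitalStarAlgHom.norm_map (localInclusion Λ Λ' h) (localInclusion_injective Λ Λ' h) a

instance : DirectedSystem LocalAlgebra (localInclusion · · ·) where
  map_self Λ a := by
    ext s t
    rw [localInclusion_apply, if_pos (fun e he => absurd e.2 he)]
  map_map Λ₃ Λ₂ Λ₁ h₁₂ h₂₃ a := by
    ext s t
    simp only [localInclusion_apply]
    by_cases h : ∀ e : Λ₃, e.1 ∉ Λ₁ → s e = t e
    · rw [if_pos h, if_pos (fun (e : Λ₃) (he : e.1 ∉ Λ₂) => h e fun h' => he (h₁₂ h')),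
        if_pos (fun (e : Λ₂) (he : e.1 ∉ Λ₁) => h ⟨e.1, h₂₃ e.2⟩ he)]
    · rw [if_neg h]
      split_ifs with h₂ h₁
      · refine absurd (fun e he => ?_) h
        by_cases he₂ : e.1 ∈ Λ₂
        · exact h₁ ⟨e.1, he₂⟩ he
        · exact h₂ e he₂
      · rfl
      · rfl

/-! ### The quasi-local algebra -/

/-- The algebra `𝒜_loc = ⋃_Λ 𝒜_Λ` of local observables: the direct limit of the `𝒜_Λ` along the
natural inclusions. -/
abbrev LocalObservables : Type := DirectLimit LocalAlgebra localInclusion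

noncomputable section

/-- The norm of a local observable is its operator norm in any `𝒜_Λ` that contains it. -/
instance : Norm LocalObservables where
  norm := DirectLimit.lift localInclusion (fun _ a => ‖a‖)
    (fun Λ Λ' h a => (norm_localInclusion Λ Λ' h a).symm)

theorem norm_mk (Λ : Finset Edge) (a : LocalAlgebra Λ) :
    ‖(⟦⟨Λ, a⟩⟧ : LocalObservables)‖ = ‖a‖ := rfl

instance : NormedAddCommGroup LocalObservables :=
  AddGroupNorm.toNormedAddCommGroup
    { toFun := fun a => ‖a‖
      map_zero' := by
        rw [DirectLimit.zero_def (f := localInclusion) (∅ : Finset Edge), norm_mk, norm_zero]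
      add_le' := fun a b => by
        induction a, b using DirectLimit.induction₂ with
        | _ Λ a b => rw [DirectLimit.add_def, norm_mk, norm_mk, norm_mk]; exact norm_add_le a b
      neg' := fun a => by
        induction a using DirectLimit.induction with
        | _ Λ a => rw [DirectLimit.neg_def, norm_mk, norm_mk, norm_neg]
      eq_zero_of_map_eq_zero' := fun a => by
        induction a using DirectLimit.induction with
        | _ Λ a =>
          intro h
          rw [norm_mk, norm_eq_zero] at h
          rw [h, ← DirectLimit.zero_def] }

instance : NormedRing LocalObservables :=
  { (inferInstance : Ring LocalObservables), (inferInstance : NormedAddCommGroup LocalObservables) with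
    norm_mul_le := fun a b => by
      induction a, b using DirectLimit.induction₂ with
      | _ Λ a b => rw [DirectLimit.mul_def, norm_mk, norm_mk, norm_mk]; exact norm_mul_le a b }

instance : NormedAlgebra ℂ LocalObservables :=
  { (inferInstance : Algebra ℂ LocalObservables) with
    norm_smul_le := fun r a => by
      induction a using DirectLimit.induction with
      | _ Λ a => rw [DirectLimit.smul_def, norm_mk, norm_mk]; exact norm_smul_le r a }

/-- The quasi-local algebra `𝒜`: the completion of `𝒜_loc` in its norm. -/
abbrev QuasiLocal : Type := UniformSpace.Completion LocalObservables

theorem norm_star_localObservables (a : LocalObservables) : ‖star a‖ = ‖a‖ := by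
  induction a using DirectLimit.induction with
  | _ Λ a => rw [DirectLimit.star_def, norm_mk, norm_mk, norm_star]

theorem isometry_star_localObservables : Isometry (star : LocalObservables → LocalObservables) :=
  AddMonoidHomClass.isometry_of_norm (starAddEquiv : LocalObservables ≃+ LocalObservables)
    norm_star_localObservables

/-- The involution of `𝒜` is the continuous extension of that of `𝒜_loc`. -/
instance : Star QuasiLocal where
  star := UniformSpace.Completion.map star

theorem star_coe (a : LocalObservables) : star (a : QuasiLocal) = ((star a : LocalObservables) : QuasiLocal) :=
  UniformSpace.Completion.map_coe isometry_star_localObservables.uniformContinuous a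

theorem continuous_star_quasiLocal : Continuous (star : QuasiLocal → QuasiLocal) :=
  UniformSpace.Completion.continuous_map

instance : StarRing QuasiLocal where
  star_involutive a := by
    induction a using UniformSpace.Completion.induction_on with
    | hp => exact isClosed_eq (continuous_star_quasiLocal.comp continuous_star_quasiLocal) continuous_id
    | ih a => rw [star_coe, star_coe, star_star]
  star_mul a b := by
    induction a, b using UniformSpace.Completion.induction_on₂ with
    | hp => exact isClosed_eq (continuous_star_quasiLocal.comp (by fun_prop))
              ((continuous_star_quasiLocal.comp continuous_snd).mul
                (continuous_star_quasiLocal.comp continuous_fst))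
    | ih a b => rw [← UniformSpace.Completion.coe_mul, star_coe, star_coe, star_coe, star_mul,
                  UniformSpace.Completion.coe_mul]
  star_add a b := by
    induction a, b using UniformSpace.Completion.induction_on₂ with
    | hp => exact isClosed_eq (continuous_star_quasiLocal.comp (by fun_prop))
              ((continuous_star_quasiLocal.comp continuous_fst).add
                (continuous_star_quasiLocal.comp continuous_snd))
    | ih a b => rw [← UniformSpace.Completion.coe_add, star_coe, star_coe, star_coe, star_add,
                  UniformSpace.Completion.coe_add]

instance : StarModule ℂ QuasiLocal where
  star_smul r a := by
    induction a using UniformSpace.Completion.induction_on with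
    | hp => exact isClosed_eq (continuous_star_quasiLocal.comp (continuous_const_smul r))
              (continuous_star_quasiLocal.const_smul (star r))
    | ih a => rw [← UniformSpace.Completion.coe_smul, star_coe, star_coe, star_smul,
                  UniformSpace.Completion.coe_smul]

instance : CStarRing QuasiLocal where
  norm_mul_self_le a := by
    induction a using UniformSpace.Completion.induction_on with
    | hp => exact isClosed_le (by fun_prop)
              ((continuous_star_quasiLocal.mul continuous_id).norm)
    | ih a =>
      rw [star_coe, ← UniformSpace.Completion.coe_mul, UniformSpace.Completion.norm_coe,
        UniformSpace.Completion.norm_coe]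
      induction a using DirectLimit.induction with
      | _ Λ a =>
        rw [DirectLimit.star_def, DirectLimit.mul_def, norm_mk, norm_mk]
        exact CStarRing.norm_mul_self_le a

/-- `𝒜` is a unital C*-algebra. -/
instance : CStarAlgebra QuasiLocal where
  norm_smul_le := norm_smul_le

/-- The inclusion `𝒜_Λ → 𝒜`. -/
def localEmbedding (Λ : Finset Edge) : LocalAlgebra Λ →⋆ₐ[ℂ] QuasiLocal where
  toFun a := ((⟦⟨Λ, a⟩⟧ : LocalObservables) : QuasiLocal)
  map_one' := by
    rw [← DirectLimit.one_def (f := localInclusion) Λ, UniformSpace.Completion.coe_one]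
  map_mul' a b := by
    rw [← DirectLimit.mul_def, UniformSpace.Completion.coe_mul]
  map_zero' := by
    rw [← DirectLimit.zero_def (f := localInclusion) Λ, UniformSpace.Completion.coe_zero]
  map_add' a b := by
    rw [← DirectLimit.add_def, UniformSpace.Completion.coe_add]
  commutes' r := by
    rw [← DirectLimit.algebraMap_def]; rfl
  map_star' a := by
    rw [star_coe, DirectLimit.star_def]

theorem norm_localEmbedding (Λ : Finset Edge) (a : LocalAlgebra Λ) : ‖localEmbedding Λ a‖ = ‖a‖ :=
  UniformSpace.Completion.norm_coe _

theorem localEmbedding_localInclusion {Λ Λ' : Finset Edge} (h : Λ ≤ Λ') (a : LocalAlgebra Λ) :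
    localEmbedding Λ' (localInclusion Λ Λ' h a) = localEmbedding Λ a :=
  congrArg (fun x : LocalObservables => (x : QuasiLocal))
    (DirectLimit.eq_of_le (f := localInclusion) ⟨Λ, a⟩ Λ' h).symm

theorem dense_iUnion_range_localEmbedding :
    Dense (⋃ Λ, Set.range (localEmbedding Λ)) := by
  refine UniformSpace.Completion.denseRange_coe.mono ?_
  rintro _ ⟨a, rfl⟩
  induction a using DirectLimit.induction with
  | _ Λ a => exact Set.mem_iUnion.2 ⟨Λ, a, rfl⟩

/-! ### Star, face and ribbon operators -/

/-- The element of `𝒜_e ⊆ 𝒜` given by a `2 × 2` matrix. -/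
def siteOperator (e : Edge) (m : Matrix (Fin 2) (Fin 2) ℂ) : QuasiLocal :=
  localEmbedding {e} (Matrix.of fun s t =>
    m (s ⟨e, Finset.mem_singleton_self e⟩) (t ⟨e, Finset.mem_singleton_self e⟩))

/-- The Pauli matrix `σˣ` at the edge `e`. -/
def sigmaX (e : Edge) : QuasiLocal := siteOperator e !![0, 1; 1, 0]

/-- The Pauli matrix `σᶻ` at the edge `e`. -/
def sigmaZ (e : Edge) : QuasiLocal := siteOperator e !![1, 0; 0, -1]

/-- The star operator `A_v`, the product of `σˣ` over the edges at `v`. -/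
def starOperator (v : Vertex) : QuasiLocal := ((starEdges v).map sigmaX).prod

/-- The face operator `B_p`, the product of `σᶻ` over the edges in the boundary of `p`. -/
def faceOperator (p : Face) : QuasiLocal := ((faceEdges p).map sigmaZ).prod

/-- The ribbon operator of a lattice path, the product of `σᶻ` over the edges of the path. -/
def ribbonZ (ρ : OpenPath endVertices) : QuasiLocal :=
  (List.ofFn fun i => sigmaZ (ρ.edge i)).prod

/-- The ribbon operator of a dual lattice path, the product of `σˣ` over the lattice edges that the
path crosses. -/
def ribbonX (ρ : OpenPath sideFaces) : QuasiLocal :=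
  (List.ofFn fun i => sigmaX (ρ.edge i)).prod

/-- The set of all ribbon operators. -/
def ribbonOperators : Set QuasiLocal := Set.range ribbonZ ∪ Set.range ribbonX

/-! ### C*-subalgebras -/

/-- The (unital) C*-subalgebra generated by a set. -/
def generatedCStar {A : Type*} [CStarAlgebra A] (S : Set A) : StarSubalgebra ℂ A :=
  (StarAlgebra.adjoin ℂ S).topologicalClosure

/-- `B` is a maximal abelian C*-subalgebra of `A`: the relative commutant of `B` in `A` is `B`
itself (in particular `B` is commutative and norm closed). -/
def IsMasa {A : Type*} [CStarAlgebra A] (B : StarSubalgebra ℂ A) : Prop :=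
  Set.centralizer (B : Set A) = (B : Set A)

/-- `a` is a normalizer of `B`: `a B a* ∪ a* B a ⊆ B`. -/
def IsNormalizer {A : Type*} [CStarAlgebra A] (B : StarSubalgebra ℂ A) (a : A) : Prop :=
  ∀ b ∈ B, a * b * star a ∈ B ∧ star a * b * a ∈ B

/-- `B` is a regular masa of `A`: it is a masa whose normalizers generate `A`. -/
def IsRegularMasa {A : Type*} [CStarAlgebra A] (B : StarSubalgebra ℂ A) : Prop :=
  IsMasa B ∧ generatedCStar {a | IsNormalizer B a} = ⊤

/-- The C*-subalgebra `𝒞` of `𝒜` generated by the star and face operators. -/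
def toricAlgebra : StarSubalgebra ℂ QuasiLocal :=
  generatedCStar (Set.range starOperator ∪ Set.range faceOperator)

end

end ToricCode

/-!
The products of Pauli matrices over finite sets of edges span a dense subalgebra of `𝒜`, and each
of them commutes or anticommutes with every star and face operator. Averaging `a` with `u a u*`,
for a star or face operator `u`, does not increase norms, fixes the commutant of `𝒞`, fixes the
Pauli operators that commute with `u` and annihilates those that anticommute with it. Hence an
element of the commutant is approximated by combinations of Pauli operators that commute with all
star and face operators. The `σᶻ`-part of such an operator is a finite mod `2` cycle of the
lattice, and its `σˣ`-part one of the dual lattice. A finite cycle is a boundary: adding faces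
moves it into a spanning tree, and the tree contains no finite cycle other than `0`. So these
Pauli operators are products of star and face operators and lie in `𝒞`.

Ribbon operators are Pauli operators, so conjugation by them changes star and face operators by
signs only, and the ribbons of length one are the Pauli matrices themselves.
-/

namespace ToricCode

/-! ### Masas generated by commuting unitaries -/

section CStar

variable {A : Type*} [CStarAlgebra A]

theorem subset_generatedCStar (S : Set A) : S ⊆ generatedCStar S :=
  (StarAlgebra.subset_adjoin ℂ S).trans (StarSubalgebra.le_topologicalClosure _)

theorem isClosed_generatedCStar (S : Set A) : IsClosed (generatedCStar S : Set A) :=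
  StarSubalgebra.isClosed_topologicalClosure _

theorem generatedCStar_le {S : Set A} {B : StarSubalgebra ℂ A} (hB : IsClosed (B : Set A))
    (h : S ⊆ B) : generatedCStar S ≤ B :=
  StarSubalgebra.topologicalClosure_minimal (StarAlgebra.adjoin_le h) hB

theorem generatedCStar_mono {S T : Set A} (h : S ⊆ T) : generatedCStar S ≤ generatedCStar T :=
  generatedCStar_le (isClosed_generatedCStar T) (h.trans (subset_generatedCStar T))

theorem generatedCStar_eq_top_of_dense {S : Set A} (h : Dense (generatedCStar S : Set A)) :
    generatedCStar S = ⊤ :=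
  SetLike.coe_injective ((isClosed_generatedCStar S).closure_eq.symm.trans h.closure_eq)

theorem generatedCStar_le_centralizer {S : Set A} (hS : S ⊆ unitary A)
    (hcomm : ∀ g ∈ S, ∀ h ∈ S, Commute g h) :
    (generatedCStar S : Set A) ⊆ Set.centralizer (generatedCStar S : Set A) := by
  have hcomm_star : ∀ g ∈ S, ∀ h ∈ S, g * star h = star h * g := fun g hg h hh =>
    (Commute.units_inv_right (u := Unitary.toUnits ⟨h, hS hh⟩) (hcomm g hg h hh)).eq
  have hunion : ∀ g ∈ S ∪ star S, ∀ h ∈ S ∪ star S, g * h = h * g := fun g hg h hh =>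
    Set.union_star_self_comm (fun x hx y hy => hcomm y hy x hx)
      (fun x hx y hy => hcomm_star y hy x hx) h hh g hg
  have hle : (generatedCStar S : Set A) ⊆ (S ∪ star S).centralizer.centralizer := by
    rw [← StarSubalgebra.coe_centralizer_centralizer ℂ]
    exact StarSubalgebra.topologicalClosure_adjoin_le_centralizer_centralizer ℂ S
  exact fun b hb c hc =>
    Set.centralizer_centralizer_comm_of_comm hunion c (hle hc) b (hle hb)

theorem isNormalizer_generatedCStar {S : Set A} {u : A} (hu : u ∈ unitary A)
    (h : ∀ g ∈ S, Commute u g ∨ SemiconjBy u g (-g)) : IsNormalizer (generatedCStar S) u := by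
  have conj_mem (v : unitary A) (hv : ∀ g ∈ S, Commute (v : A) g ∨ SemiconjBy (v : A) g (-g)) :
      ∀ b ∈ generatedCStar S, (v : A) * b * star (v : A) ∈ generatedCStar S := by
    refine fun b hb => generatedCStar_le
      (B := (generatedCStar S).comap (Unitary.conjStarAlgAut ℂ A v : A →⋆ₐ[ℂ] A))
      ((isClosed_generatedCStar S).preimage (f := fun a => (v : A) * a * star (v : A))
        (by fun_prop)) (fun g hg => ?_) hb
    change (v : A) * g * star (v : A) ∈ generatedCStar S
    have hgS := subset_generatedCStar S hg
    rcases hv g hg with hvg | hvg <;>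
      rw [hvg.eq, mul_assoc, Unitary.mul_star_self_of_mem v.2, mul_one]
    exacts [hgS, neg_mem hgS]
  have star_rel (g : A) (hg : g ∈ S) : Commute (star u) g ∨ SemiconjBy (star u) g (-g) := by
    refine (h g hg).imp (Commute.units_inv_left (u := Unitary.toUnits ⟨u, hu⟩)) fun hug => ?_
    have hinv : SemiconjBy (star u) (-g) g :=
      SemiconjBy.units_inv_symm_left (a := Unitary.toUnits ⟨u, hu⟩) hug
    simpa only [neg_neg] using hinv.neg_right
  refine fun b hb => ⟨conj_mem ⟨u, hu⟩ h b hb, ?_⟩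
  simpa only [Unitary.coe_star, star_star] using conj_mem (star ⟨u, hu⟩) star_rel b hb

/-- The conditional expectation `a ↦ (a + u a u*) / 2` attached to a unitary `u`: it fixes what
commutes with `u` and annihilates what anticommutes with `u`. -/
noncomputable def average (u : unitary A) : A →ₗ[ℂ] A :=
  (2⁻¹ : ℂ) • (LinearMap.id + (Unitary.conjStarAlgAut ℂ A u : A →⋆ₐ[ℂ] A).toLinearMap)

theorem average_apply (u : unitary A) (a : A) :
    average u a = (2⁻¹ : ℂ) • (a + u * a * star (u : A)) := rfl

theorem norm_average_le (u : unitary A) (a : A) : ‖average u a‖ ≤ ‖a‖ :=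
  calc ‖average u a‖ ≤ 2⁻¹ * (‖a‖ + ‖u * a * star (u : A)‖) := by
        rw [average_apply, norm_smul, norm_inv, Complex.norm_ofNat]
        gcongr
        exact norm_add_le _ _
    _ = ‖a‖ := by
        rw [← Unitary.coe_star, CStarRing.norm_mul_coe_unitary, CStarRing.norm_coe_unitary_mul]
        ring

theorem average_eq_self {u : unitary A} {a : A} (h : Commute (u : A) a) : average u a = a := by
  rw [average_apply, h.eq, mul_assoc, Unitary.mul_star_self_of_mem u.2, mul_one, ← two_smul ℂ,
    inv_smul_smul₀ two_ne_zero]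

theorem average_eq_zero {u : unitary A} {a : A} (h : SemiconjBy (u : A) a (-a)) :
    average u a = 0 := by
  rw [average_apply, h.eq, mul_assoc, Unitary.mul_star_self_of_mem u.2, mul_one, add_neg_cancel,
    smul_zero]

theorem average_mem_span {u : unitary A} {s : Set A}
    (hs : ∀ p ∈ s, Commute (u : A) p ∨ SemiconjBy (u : A) p (-p)) {b : A}
    (hb : b ∈ Submodule.span ℂ s) : average u b ∈ Submodule.span ℂ s := by
  refine (Submodule.span_le (p := (Submodule.span ℂ s).comap (average u))).2 (fun p hp => ?_) hb
  rcases hs p hp with h | h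
  · simpa only [SetLike.mem_coe, Submodule.mem_comap, average_eq_self h]
      using Submodule.subset_span hp
  · simp only [SetLike.mem_coe, Submodule.mem_comap, average_eq_zero h, zero_mem]

/-- Averaging over the unitaries that anticommute with the terms outside the subalgebra removes
these terms one at a time. -/
theorem exists_norm_sub_le_of_mem_span {B : StarSubalgebra ℂ A} {U : Set (unitary A)} {P : Set A}
    (hUB : ∀ u ∈ U, (u : A) ∈ B) (hB : (B : Set A) ⊆ Set.centralizer (B : Set A))
    (hUP : ∀ u ∈ U, ∀ p ∈ P, Commute (u : A) p ∨ SemiconjBy (u : A) p (-p))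
    (hPB : ∀ p ∈ P, p ∈ B ∨ ∃ u ∈ U, SemiconjBy (u : A) p (-p))
    (s : Finset A) (hs : (s : Set A) ⊆ P) {a : A} (ha : a ∈ Set.centralizer (B : Set A)) {b : A}
    (hb : b ∈ Submodule.span ℂ (s : Set A)) : ∃ c ∈ B, ‖a - c‖ ≤ ‖a - b‖ := by
  classical
  induction s using Finset.induction_on generalizing a b with
  | empty =>
    have hb0 : b = 0 := by simpa using hb
    exact ⟨0, zero_mem B, hb0 ▸ le_rfl⟩
  | insert p s _ ih =>
    rw [Finset.coe_insert, Set.insert_subset_iff] at hs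
    rw [Finset.coe_insert] at hb
    obtain ⟨z, b', hb', rfl⟩ := Submodule.mem_span_insert.1 hb
    rcases hPB p hs.1 with hpB | ⟨u, hu, hup⟩
    · have hzp : z • p ∈ B := B.smul_mem hpB z
      have ha' : a - z • p ∈ Set.centralizer (B : Set A) := fun x hx => by
        rw [mul_sub, sub_mul, ha x hx, hB hzp x hx]
      obtain ⟨c, hc, hcb⟩ := ih hs.2 ha' hb'
      exact ⟨z • p + c, add_mem hzp hc, by simpa only [sub_sub] using hcb⟩
    · obtain ⟨c, hc, hcb⟩ := ih hs.2 ha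
        (average_mem_span (fun q hq => hUP u hu q (hs.2 hq)) hb')
      refine ⟨c, hc, hcb.trans ?_⟩
      calc ‖a - average u b'‖ = ‖average u (a - (z • p + b'))‖ := by
            rw [map_sub, map_add, map_smul, average_eq_zero hup, smul_zero, zero_add,
              average_eq_self (ha u (hUB u hu))]
        _ ≤ ‖a - (z • p + b')‖ := norm_average_le u _

theorem isMasa_generatedCStar {S P : Set A} (hS : S ⊆ unitary A)
    (hcomm : ∀ g ∈ S, ∀ h ∈ S, Commute g h) (hP : Dense (Submodule.span ℂ P : Set A))
    (hSP : ∀ g ∈ S, ∀ p ∈ P, Commute g p ∨ SemiconjBy g p (-p))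
    (hPS : ∀ p ∈ P, p ∈ generatedCStar S ∨ ∃ g ∈ S, SemiconjBy g p (-p)) :
    IsMasa (generatedCStar S) := by
  have hle := generatedCStar_le_centralizer hS hcomm
  refine Set.Subset.antisymm (fun a ha => ?_) hle
  rw [← (isClosed_generatedCStar S).closure_eq, Metric.mem_closure_iff]
  intro ε hε
  obtain ⟨b, hab, hb⟩ := Metric.dense_iff.1 hP a ε hε
  obtain ⟨s, hs, hbs⟩ := Submodule.mem_span_finite_of_mem_span hb
  obtain ⟨c, hc, hcb⟩ := exists_norm_sub_le_of_mem_span (U := {u : unitary A | (u : A) ∈ S})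
    (fun u hu => subset_generatedCStar S hu) hle (fun u hu => hSP u hu)
    (fun p hp => (hPS p hp).imp_right fun ⟨g, hg, hgp⟩ => ⟨⟨g, hS hg⟩, hg, hgp⟩) s hs ha hbs
  refine ⟨c, hc, ?_⟩
  rw [dist_eq_norm]
  rw [Metric.mem_ball, dist_comm, dist_eq_norm] at hab
  exact hcb.trans_lt hab

end CStar

/-! ### Pauli matrices at the edges -/

/-- `siteOperator e` as a homomorphism of the `2 × 2` matrices into the quasi-local algebra. -/
noncomputable def siteHom (e : Edge) : Matrix (Fin 2) (Fin 2) ℂ →⋆ₐ[ℂ] QuasiLocal :=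
  (localEmbedding {e}).comp
    { (Matrix.reindexAlgEquiv ℂ ℂ
        (Equiv.funUnique ({e} : Finset Edge) (Fin 2)).symm).toAlgHom with
      map_star' := fun _ => rfl }

theorem sigmaX_eq_siteHom (e : Edge) : sigmaX e = siteHom e !![0, 1; 1, 0] := rfl

theorem sigmaZ_eq_siteHom (e : Edge) : sigmaZ e = siteHom e !![1, 0; 0, -1] := rfl

theorem localEmbedding_singleton (e : Edge) (a : LocalAlgebra {e}) :
    localEmbedding {e} a =
      siteHom e (Matrix.reindex (Equiv.funUnique _ _) (Equiv.funUnique _ _) a) := by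
  refine congrArg (localEmbedding {e}) ?_
  ext s t
  exact congrArg₂ a ((Equiv.symm_apply_apply (Equiv.funUnique _ _) s).symm)
    ((Equiv.symm_apply_apply (Equiv.funUnique _ _) t).symm)

theorem sigmaX_mul_self (e : Edge) : sigmaX e * sigmaX e = 1 := by
  rw [sigmaX_eq_siteHom, ← map_mul, ← map_one (siteHom e)]
  simp [Matrix.one_fin_two]

theorem sigmaZ_mul_self (e : Edge) : sigmaZ e * sigmaZ e = 1 := by
  rw [sigmaZ_eq_siteHom, ← map_mul, ← map_one (siteHom e)]
  simp [Matrix.one_fin_two]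

theorem star_sigmaX (e : Edge) : star (sigmaX e) = sigmaX e := by
  rw [sigmaX_eq_siteHom, ← map_star]
  congr 1
  ext i j; fin_cases i <;> fin_cases j <;> simp

theorem star_sigmaZ (e : Edge) : star (sigmaZ e) = sigmaZ e := by
  rw [sigmaZ_eq_siteHom, ← map_star]
  congr 1
  ext i j; fin_cases i <;> fin_cases j <;> simp

theorem semiconjBy_sigmaX_sigmaZ (e : Edge) : SemiconjBy (sigmaX e) (sigmaZ e) (-sigmaZ e) := by
  rw [SemiconjBy, neg_mul, sigmaX_eq_siteHom, sigmaZ_eq_siteHom, ← map_mul (siteHom e),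
    ← map_mul (siteHom e), ← map_neg]
  simp

/-- The restriction of a configuration to a smaller set of edges. -/
def restrictConfig {Λ Λ' : Finset Edge} (h : Λ ≤ Λ') (s : Λ' → Fin 2) : Λ → Fin 2 :=
  fun e => s ⟨e.1, h e.2⟩

theorem localInclusion_mul_localInclusion_apply {Λ₁ Λ₂ Λ : Finset Edge} (h₁ : Λ₁ ≤ Λ)
    (h₂ : Λ₂ ≤ Λ) (hd : Disjoint Λ₁ Λ₂) (a : LocalAlgebra Λ₁) (b : LocalAlgebra Λ₂)
    (s t : Λ → Fin 2) :
    (localInclusion Λ₁ Λ h₁ a * localInclusion Λ₂ Λ h₂ b) s t =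
      if ∀ e : Λ, e.1 ∉ Λ₁ → e.1 ∉ Λ₂ → s e = t e then
        a (restrictConfig h₁ s) (restrictConfig h₁ t) *
          b (restrictConfig h₂ s) (restrictConfig h₂ t)
      else 0 := by
  have hnot {e : Edge} (he : e ∈ Λ₂) : e ∉ Λ₁ := fun he' => Finset.disjoint_left.1 hd he' he
  rw [Matrix.mul_apply, Finset.sum_eq_single (fun e : Λ => if e.1 ∈ Λ₁ then t e else s e)]
  · rw [localInclusion_apply, localInclusion_apply,
      if_pos fun (e : Λ) (he : e.1 ∉ Λ₁) => (if_neg he).symm]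
    have h : (∀ e : Λ, e.1 ∉ Λ₂ → (if e.1 ∈ Λ₁ then t e else s e) = t e) ↔
        ∀ e : Λ, e.1 ∉ Λ₁ → e.1 ∉ Λ₂ → s e = t e := by
      grind
    simp only [h, mul_ite, mul_zero, Finset.coe_mem, if_true, hnot, if_false]
    rfl
  · intro w _ hw
    obtain ⟨e, he⟩ := Function.ne_iff.1 hw
    rw [localInclusion_apply, localInclusion_apply]
    by_cases he₁ : e.1 ∈ Λ₁
    · rw [if_pos he₁] at he
      rw [if_neg (c := ∀ e : Λ, e.1 ∉ Λ₂ → w e = t e)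
        fun h => he (h e (Finset.disjoint_left.1 hd he₁)), mul_zero]
    · rw [if_neg he₁] at he
      rw [if_neg (c := ∀ e : Λ, e.1 ∉ Λ₁ → s e = w e) fun h => he (h e he₁).symm, zero_mul]
  · exact fun h => absurd (Finset.mem_univ _) h

theorem eq_iff_restrictConfig_union_eq {Λ₁ Λ₂ : Finset Edge} {s t : ↥(Λ₁ ∪ Λ₂) → Fin 2} :
    s = t ↔ restrictConfig Finset.subset_union_left s = restrictConfig Finset.subset_union_left t ∧
      restrictConfig Finset.subset_union_right s = restrictConfig Finset.subset_union_right t := by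
  simp only [funext_iff, Subtype.forall, Finset.mem_union, restrictConfig]
  exact ⟨fun h => ⟨fun e he => h e (.inl he), fun e he => h e (.inr he)⟩,
    fun h e he => he.elim (h.1 e) (h.2 e)⟩

theorem single_eq_localInclusion_mul_localInclusion {Λ₁ Λ₂ : Finset Edge} (hd : Disjoint Λ₁ Λ₂)
    (s t : ↥(Λ₁ ∪ Λ₂) → Fin 2) (c : ℂ) :
    Matrix.single s t c =
      localInclusion Λ₁ (Λ₁ ∪ Λ₂) Finset.subset_union_left
          (Matrix.single (restrictConfig Finset.subset_union_left s)
            (restrictConfig Finset.subset_union_left t) 1) *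
        localInclusion Λ₂ (Λ₁ ∪ Λ₂) Finset.subset_union_right
          (Matrix.single (restrictConfig Finset.subset_union_right s)
            (restrictConfig Finset.subset_union_right t) c) := by
  ext u v
  rw [localInclusion_mul_localInclusion_apply _ _ hd,
    if_pos fun e h₁ h₂ => (Finset.mem_union.1 e.2).elim (absurd · h₁) (absurd · h₂)]
  simp only [Matrix.single_apply, ite_mul, one_mul, zero_mul, ← ite_and,
    eq_iff_restrictConfig_union_eq, and_and_and_comm]

theorem commute_localEmbedding_of_disjoint {Λ₁ Λ₂ : Finset Edge} (hd : Disjoint Λ₁ Λ₂)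
    (a : LocalAlgebra Λ₁) (b : LocalAlgebra Λ₂) :
    Commute (localEmbedding Λ₁ a) (localEmbedding Λ₂ b) := by
  have h₁ : Λ₁ ≤ Λ₁ ∪ Λ₂ := Finset.subset_union_left
  have h₂ : Λ₂ ≤ Λ₁ ∪ Λ₂ := Finset.subset_union_right
  rw [← localEmbedding_localInclusion h₁, ← localEmbedding_localInclusion h₂]
  refine Commute.map (f := localEmbedding (Λ₁ ∪ Λ₂)) ?_
  ext s t
  rw [localInclusion_mul_localInclusion_apply h₁ h₂ hd,
    localInclusion_mul_localInclusion_apply h₂ h₁ hd.symm, mul_comm]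
  exact if_congr (forall_congr' fun e => imp.swap) rfl rfl

theorem commute_siteOperator {e f : Edge} (h : e ≠ f) (m n : Matrix (Fin 2) (Fin 2) ℂ) :
    Commute (siteOperator e m) (siteOperator f n) :=
  commute_localEmbedding_of_disjoint (Finset.disjoint_singleton.2 h) _ _

theorem commute_sigmaX (e f : Edge) : Commute (sigmaX e) (sigmaX f) := by
  rcases eq_or_ne e f with rfl | h
  exacts [Commute.refl _, commute_siteOperator h _ _]

theorem commute_sigmaZ (e f : Edge) : Commute (sigmaZ e) (sigmaZ f) := by
  rcases eq_or_ne e f with rfl | h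
  exacts [Commute.refl _, commute_siteOperator h _ _]

section Generation

variable {D : Subalgebra ℂ QuasiLocal} (hX : ∀ e, sigmaX e ∈ D) (hZ : ∀ e, sigmaZ e ∈ D)
include hX hZ

theorem siteHom_mem (e : Edge) (m : Matrix (Fin 2) (Fin 2) ℂ) : siteHom e m ∈ D := by
  have hm : m = ((m 0 0 + m 1 1) / 2) • 1 + ((m 0 0 - m 1 1) / 2) • !![1, 0; 0, -1] +
      ((m 0 1 + m 1 0) / 2) • !![0, 1; 1, 0] +
      ((m 0 1 - m 1 0) / 2) • (!![1, 0; 0, -1] * !![0, 1; 1, 0]) := by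
    ext i j
    fin_cases i <;> fin_cases j <;> simp <;> ring
  rw [hm]
  simp only [map_add, map_smul, map_mul, map_one]
  exact D.add_mem (D.add_mem (D.add_mem (D.smul_mem D.one_mem _) (D.smul_mem (hZ e) _))
    (D.smul_mem (hX e) _)) (D.smul_mem (D.mul_mem (hZ e) (hX e)) _)

theorem localEmbedding_mem (Λ : Finset Edge) (a : LocalAlgebra Λ) : localEmbedding Λ a ∈ D := by
  induction Λ using Finset.induction_on with
  | empty =>
    have ha : a = algebraMap ℂ _ (a default default) := by
      ext s t
      rw [Subsingleton.elim s default, Subsingleton.elim t default]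
      simp [Matrix.algebraMap_matrix_apply]
    rw [ha, AlgHomClass.commutes]
    exact D.algebraMap_mem _
  | insert e Λ he ih =>
    revert a
    rw [Finset.insert_eq]
    intro a
    rw [Matrix.matrix_eq_sum_single a, map_sum]
    refine D.sum_mem fun s _ => ?_
    rw [map_sum]
    refine D.sum_mem fun t _ => ?_
    rw [single_eq_localInclusion_mul_localInclusion (Finset.disjoint_singleton_left.2 he), map_mul,
      localEmbedding_localInclusion, localEmbedding_localInclusion, localEmbedding_singleton]
    exact D.mul_mem (siteHom_mem hX hZ e _) (ih _)

theorem dense_of_sigma_mem : Dense (D : Set QuasiLocal) := by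
  refine dense_iUnion_range_localEmbedding.mono (Set.iUnion_subset fun Λ => ?_)
  rintro _ ⟨a, rfl⟩
  exact localEmbedding_mem hX hZ Λ a

end Generation

/-! ### Finite cycles modulo `2` on the lattice -/

section Chains

variable {ι : Type*}

theorem chain_induction {p : (ι →₀ ZMod 2) → Prop} (T : ι →₀ ZMod 2) (zero : p 0)
    (add : ∀ S T, p S → p T → p (S + T)) (single : ∀ i, p (Finsupp.single i 1)) : p T := by
  induction T using Finsupp.induction_linear with
  | zero => exact zero
  | add S T hS hT => exact add S T hS hT
  | single i c =>
    fin_cases c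
    · exact (Finsupp.single_zero i : Finsupp.single i (0 : ZMod 2) = 0).symm ▸ zero
    · exact single i

theorem span_chain_induction {s : Set (ι →₀ ZMod 2)} {p : (ι →₀ ZMod 2) → Prop} {T : ι →₀ ZMod 2}
    (hT : T ∈ Submodule.span (ZMod 2) s) (mem : ∀ S ∈ s, p S) (zero : p 0)
    (add : ∀ S T, p S → p T → p (S + T)) : p T := by
  induction hT using Submodule.span_induction with
  | mem S hS => exact mem S hS
  | zero => exact zero
  | add S T _ _ hS hT => exact add S T hS hT
  | smul c S _ hS =>
    rcases (by decide : ∀ c : ZMod 2, c = 0 ∨ c = 1) c with rfl | rfl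
    · rwa [zero_smul]
    · rwa [one_smul]

/-- The mod `2` chain of a list. -/
noncomputable def listChain (l : List ι) : ι →₀ ZMod 2 := (l.map (Finsupp.single · 1)).sum

/-- The number of common elements of two chains, modulo `2`. For chains of edges of the lattice and
of the dual lattice this is their intersection number. -/
noncomputable def crossing : LinearMap.BilinForm (ZMod 2) (ι →₀ ZMod 2) :=
  Finsupp.linearCombination (ZMod 2) Finsupp.lapply

theorem crossing_single_left (i : ι) (T : ι →₀ ZMod 2) :
    crossing (Finsupp.single i 1) T = T i := by
  rw [crossing, Finsupp.linearCombination_single, one_smul, Finsupp.lapply_apply]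

theorem crossing_listChain (l : List ι) (T : ι →₀ ZMod 2) :
    crossing (listChain l) T = (l.map T).sum := by
  induction l with
  | nil => exact LinearMap.map_zero₂ _ _
  | cons i l ih =>
    rw [List.map_cons, List.sum_cons, ← ih, ← crossing_single_left, ← LinearMap.map_add₂]
    rfl

theorem crossing_comm (S T : ι →₀ ZMod 2) : crossing S T = crossing T S := by
  induction S using chain_induction with
  | zero => rw [LinearMap.map_zero₂, map_zero]
  | add S S' hS hS' => rw [LinearMap.map_add₂, map_add, hS, hS']
  | single i =>
    induction T using chain_induction with
    | zero => rw [LinearMap.map_zero₂, map_zero]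
    | add T T' hT hT' => rw [LinearMap.map_add₂, map_add, hT, hT']
    | single j =>
      classical
      rw [crossing_single_left, crossing_single_left, Finsupp.single_apply, Finsupp.single_apply,
        if_congr eq_comm rfl rfl]

theorem chain_eq_zero_of_const_along (T : ι →₀ ZMod 2) {g : ℕ → ι} (hg : Function.Injective g)
    (h : ∀ n, T (g (n + 1)) = T (g n)) : T (g 0) = 0 := by
  by_contra h0
  have hconst (n : ℕ) : T (g n) = T (g 0) := by
    induction n with
    | zero => rfl
    | succ n ih => rw [h, ih]
  refine Set.infinite_range_of_injective hg (T.support.finite_toSet.subset ?_)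
  rintro _ ⟨n, rfl⟩
  rwa [SetLike.mem_coe, Finsupp.mem_support_iff, hconst n]

end Chains

section Lattice

/-- The finite mod `2` chains of edges. -/
abbrev Chain : Type := Edge →₀ ZMod 2

/-- The coboundary of a vertex. -/
noncomputable def starChain (v : Vertex) : Chain := listChain (starEdges v)

/-- The boundary of a face. -/
noncomputable def faceChain (p : Face) : Chain := listChain (faceEdges p)

theorem crossing_starChain (x y : ℤ) (T : Chain) : crossing (starChain (x, y)) T =
    T ((x, y), false) + (T ((x, y), true) + (T ((x - 1, y), false) + T ((x, y - 1), true))) := by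
  simp [starChain, crossing_listChain, starEdges]

theorem faceChain_eq (x y : ℤ) : faceChain (x, y) =
    Finsupp.single ((x, y), false) 1 + (Finsupp.single ((x + 1, y), true) 1 +
      (Finsupp.single ((x, y + 1), false) 1 + Finsupp.single ((x, y), true) 1)) := by
  simp [faceChain, listChain, faceEdges]

theorem crossing_starChain_horizontal (v : Vertex) (x y : ℤ) :
    crossing (starChain v) (Finsupp.single ((x, y), false) 1) =
      Finsupp.single (x, y) 1 v + Finsupp.single (x + 1, y) 1 v := by
  obtain ⟨a, b⟩ := v
  simp [crossing_starChain, Finsupp.single_apply, eq_sub_iff_add_eq]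

theorem crossing_starChain_vertical (v : Vertex) (x y : ℤ) :
    crossing (starChain v) (Finsupp.single ((x, y), true) 1) =
      Finsupp.single (x, y) 1 v + Finsupp.single (x, y + 1) 1 v := by
  obtain ⟨a, b⟩ := v
  simp [crossing_starChain, Finsupp.single_apply, eq_sub_iff_add_eq]

/-- Each corner of a face lies on two of its edges. -/
theorem crossing_starChain_faceChain (v : Vertex) (p : Face) :
    crossing (starChain v) (faceChain p) = 0 := by
  obtain ⟨x, y⟩ := p
  rw [faceChain_eq, map_add, map_add, map_add, crossing_starChain_horizontal,
    crossing_starChain_vertical, crossing_starChain_horizontal, crossing_starChain_vertical]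
  grind

/-- The group of boundaries of finite sets of faces. -/
noncomputable def boundaries : Submodule (ZMod 2) Chain :=
  Submodule.span (ZMod 2) (Set.range faceChain)

theorem crossing_starChain_of_mem_boundaries {T : Chain} (hT : T ∈ boundaries) (v : Vertex) :
    crossing (starChain v) T = 0 := by
  refine (Submodule.span_le (p := LinearMap.ker (crossing (starChain v)))).2 ?_ hT
  rintro _ ⟨p, rfl⟩
  exact crossing_starChain_faceChain v p

/-- The comb: the spanning tree of the lattice that consists of all vertical lines and of the
horizontal line `y = 0`. -/
def comb : Set Edge := {e | e.2 = true ∨ e.1.2 = 0}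

theorem boundaries_sup_supported_comb :
    boundaries ⊔ Finsupp.supported (ZMod 2) (ZMod 2) comb = ⊤ := by
  have hcomb {e : Edge} (he : e ∈ comb) :
      Finsupp.single e 1 ∈ boundaries ⊔ Finsupp.supported (ZMod 2) (ZMod 2) comb :=
    Submodule.mem_sup_right (Finsupp.single_mem_supported _ _ he)
  have hstep (x y : ℤ) : Finsupp.single ((x, y), false) 1 + Finsupp.single ((x, y + 1), false) 1 ∈
      boundaries ⊔ Finsupp.supported (ZMod 2) (ZMod 2) comb := by
    have hface : faceChain (x, y) ∈ boundaries ⊔ Finsupp.supported (ZMod 2) (ZMod 2) comb :=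
      Submodule.mem_sup_left (Submodule.subset_span ⟨_, rfl⟩)
    rw [faceChain_eq] at hface
    convert sub_mem (sub_mem hface (hcomb (.inl rfl : ((x, y), true) ∈ comb)))
      (hcomb (.inl rfl : ((x + 1, y), true) ∈ comb)) using 1
    abel
  have hhorizontal (x y : ℤ) :
      Finsupp.single ((x, y), false) 1 ∈ boundaries ⊔ Finsupp.supported (ZMod 2) (ZMod 2) comb := by
    induction y using Int.induction_on with
    | zero => exact hcomb (.inr rfl)
    | succ y ih => exact (add_mem_cancel_left ih).1 (hstep x y)
    | pred y ih =>
      have h := hstep x (-y - 1)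
      rw [sub_add_cancel] at h
      exact (add_mem_cancel_right ih).1 h
  refine eq_top_iff.2 fun T _ => chain_induction T (zero_mem _) (fun _ _ => add_mem) ?_
  rintro ⟨⟨x, y⟩, _ | _⟩
  exacts [hhorizontal x y, hcomb (.inl rfl)]

theorem eq_zero_of_mem_supported_comb {T : Chain}
    (hT : T ∈ Finsupp.supported (ZMod 2) (ZMod 2) comb)
    (hcycle : ∀ v, crossing (starChain v) T = 0) : T = 0 := by
  have hrow (x y : ℤ) (hy : y ≠ 0) : T ((x, y), false) = 0 :=
    (Finsupp.mem_supported' _ _).1 hT _ (by simp [comb, hy])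
  have hstar (x y : ℤ) := (crossing_starChain x y T).symm.trans (hcycle (x, y))
  have hup (x y : ℤ) (hy : y ≠ 0) : T ((x, y), true) = T ((x, y - 1), true) := by
    simpa only [hrow _ y hy, zero_add, CharTwo.add_eq_zero] using hstar x y
  have hvertical (x y : ℤ) : T ((x, y), true) = 0 := by
    rcases le_or_gt 0 y with hy | hy
    · simpa using chain_eq_zero_of_const_along T (g := fun n => ((x, y + n), true))
        (fun m n h => by simpa using h) fun n => by
          rw [hup x _ (by omega), Nat.cast_succ, ← add_assoc, add_sub_cancel_right]
    · simpa using chain_eq_zero_of_const_along T (g := fun n => ((x, y - n), true))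
        (fun m n h => by simpa using h) fun n => by
          rw [hup x (y - n) (by omega), Nat.cast_succ, sub_sub]
  have hhorizontal (x : ℤ) : T ((x, 0), false) = 0 := by
    simpa using chain_eq_zero_of_const_along T (g := fun n => ((x + n, 0), false))
      (fun m n h => by simpa using h) fun n => by
        have h := hstar (x + (n + 1 : ℕ)) 0
        rw [hvertical, hvertical, zero_add, add_zero, CharTwo.add_eq_zero] at h
        rw [h, Nat.cast_succ, ← add_assoc, add_sub_cancel_right]
  ext ⟨⟨x, y⟩, _ | _⟩
  · rcases eq_or_ne y 0 with rfl | hy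
    exacts [hhorizontal x, hrow x y hy]
  · exact hvertical x y

theorem mem_boundaries {T : Chain} (hT : ∀ v, crossing (starChain v) T = 0) :
    T ∈ boundaries := by
  obtain ⟨B, hB, N, hN, rfl⟩ :=
    Submodule.mem_sup.1 (boundaries_sup_supported_comb ▸ Submodule.mem_top (x := T))
  have hN0 : N = 0 := eq_zero_of_mem_supported_comb hN fun v => by
    simpa only [map_add, crossing_starChain_of_mem_boundaries hB, zero_add] using hT v
  rwa [hN0, add_zero]

/-- The symmetry of the set of edges that exchanges the lattice and the dual lattice. -/
def dualEdge : Equiv.Perm Edge :=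
  Function.Involutive.toPerm (fun e => (-e.1, !e.2)) fun e => by simp

/-- The action of `dualEdge` on chains. -/
noncomputable def dualChain : Chain ≃ₗ[ZMod 2] Chain := Finsupp.domLCongr dualEdge

theorem dualChain_single (e : Edge) :
    dualChain (Finsupp.single e 1) = Finsupp.single (-e.1, !e.2) 1 :=
  Finsupp.domLCongr_single _ _ _

theorem dualChain_dualChain (T : Chain) : dualChain (dualChain T) = T :=
  Finsupp.ext fun e => congrArg T (dualEdge.apply_symm_apply e)

theorem crossing_dualChain (S T : Chain) : crossing (dualChain S) (dualChain T) = crossing S T := by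
  induction S using chain_induction with
  | zero => rw [map_zero, LinearMap.map_zero₂, LinearMap.map_zero₂]
  | add S S' hS hS' => rw [map_add, LinearMap.map_add₂, LinearMap.map_add₂, hS, hS']
  | single e =>
    rw [dualChain_single, crossing_single_left, crossing_single_left]
    exact congrArg T (dualEdge.symm_apply_apply e)

theorem dualChain_faceChain (p : Face) : dualChain (faceChain p) = starChain (-p) := by
  obtain ⟨x, y⟩ := p
  simp only [faceChain_eq, map_add, dualChain_single, Prod.neg_mk, neg_add',
    Bool.not_true, Bool.not_false, starChain, listChain, starEdges, List.map_cons, List.map_nil,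
    List.sum_cons, List.sum_nil, add_zero]
  abel

/-- The group generated by the coboundaries of the vertices. -/
noncomputable def coboundaries : Submodule (ZMod 2) Chain :=
  Submodule.span (ZMod 2) (Set.range starChain)

theorem mem_coboundaries {T : Chain} (hT : ∀ p, crossing (faceChain p) T = 0) :
    T ∈ coboundaries := by
  have hdual : dualChain T ∈ boundaries := mem_boundaries fun v => by
    rw [← neg_neg v, ← dualChain_faceChain, crossing_dualChain, hT]
  have hle : boundaries ≤ coboundaries.comap (dualChain : Chain →ₗ[ZMod 2] Chain) := by
    refine Submodule.span_le.2 ?_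
    rintro _ ⟨p, rfl⟩
    exact Submodule.subset_span ⟨-p, (dualChain_faceChain p).symm⟩
  exact dualChain_dualChain T ▸ hle hdual

end Lattice

/-! ### Pauli operators -/

section Signs

variable {A : Type*} [Ring A]

/-- `x` and `y` commute up to the sign `ε`. -/
def CommuteUpToSign (ε : ℤˣ) (x y : A) : Prop := x * y = ε • (y * x)

namespace CommuteUpToSign

variable {ε δ : ℤˣ} {x y z : A}

theorem of_commute (h : Commute x y) : CommuteUpToSign 1 x y :=
  h.eq.trans (one_smul _ _).symm

theorem of_semiconjBy_neg (h : SemiconjBy x y (-y)) : CommuteUpToSign (-1) x y := by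
  rw [CommuteUpToSign, h.eq, Units.neg_smul, one_smul, neg_mul]

theorem symm (h : CommuteUpToSign ε x y) : CommuteUpToSign ε y x := by
  rw [CommuteUpToSign, h, smul_smul, Int.units_mul_self, one_smul]

theorem mul_right (hy : CommuteUpToSign ε x y) (hz : CommuteUpToSign δ x z) :
    CommuteUpToSign (ε * δ) x (y * z) := by
  rw [CommuteUpToSign, ← mul_assoc, hy, smul_mul_assoc, mul_assoc, hz, mul_smul_comm, smul_smul,
    mul_assoc]

theorem mul_left (hx : CommuteUpToSign ε x z) (hy : CommuteUpToSign δ y z) :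
    CommuteUpToSign (ε * δ) (x * y) z :=
  (hx.symm.mul_right hy.symm).symm

theorem commute (h : CommuteUpToSign 1 x y) : Commute x y :=
  h.trans (one_smul _ _)

theorem semiconjBy_neg (h : CommuteUpToSign (-1) x y) : SemiconjBy x y (-y) := by
  rw [SemiconjBy, h, Units.neg_smul, one_smul, neg_mul]

theorem commute_or_semiconjBy_neg (h : CommuteUpToSign ε x y) :
    Commute x y ∨ SemiconjBy x y (-y) := by
  rcases Int.units_eq_one_or ε with rfl | rfl
  exacts [.inl h.commute, .inr h.semiconjBy_neg]

end CommuteUpToSign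

end Signs

section Involutions

variable {ι G : Type*} [Group G] {s : ι → G}

theorem isMulCommutative_closure_range (hc : ∀ i j, Commute (s i) (s j)) :
    IsMulCommutative (Subgroup.closure (Set.range s)) :=
  Subgroup.isMulCommutative_closure <|
    Set.forall_mem_range.2 fun i => Set.forall_mem_range.2 fun j => hc i j

open scoped IsMulCommutative in
/-- The product, over the elements of a mod `2` chain, of pairwise commuting involutions. -/
noncomputable def involutionHom (hs : ∀ i, s i * s i = 1) (hc : ∀ i j, Commute (s i) (s j)) :
    (ι →₀ ZMod 2) →+ Additive G :=
  have := isMulCommutative_closure_range hc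
  let t (i : ι) : Additive (Subgroup.closure (Set.range s)) :=
    .ofMul ⟨s i, Subgroup.subset_closure ⟨i, rfl⟩⟩
  (Subgroup.closure (Set.range s)).subtype.toAdditive.comp <|
    Finsupp.liftAddHom (N := Additive (Subgroup.closure (Set.range s))) fun i => ZMod.lift 2
      ⟨zmultiplesHom _ (t i), by
        rw [zmultiplesHom_apply, natCast_zsmul, two_nsmul]
        exact Subtype.ext (hs i)⟩

open scoped IsMulCommutative in
theorem involutionHom_single (hs : ∀ i, s i * s i = 1) (hc : ∀ i j, Commute (s i) (s j)) (i : ι) :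
    involutionHom hs hc (Finsupp.single i 1) = .ofMul (s i) := by
  have := isMulCommutative_closure_range hc
  rw [involutionHom, AddMonoidHom.comp_apply, Finsupp.liftAddHom_apply_single,
    ← Int.cast_one (R := ZMod 2), ZMod.lift_coe, zmultiplesHom_apply, one_zsmul]
  rfl

end Involutions

section PauliOperators

/-- `σˣ` at an edge, as a unitary. -/
noncomputable def unitaryX (e : Edge) : unitary QuasiLocal :=
  ⟨sigmaX e, by rw [Unitary.mem_iff, star_sigmaX, sigmaX_mul_self]; exact ⟨rfl, rfl⟩⟩

/-- `σᶻ` at an edge, as a unitary. -/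
noncomputable def unitaryZ (e : Edge) : unitary QuasiLocal :=
  ⟨sigmaZ e, by rw [Unitary.mem_iff, star_sigmaZ, sigmaZ_mul_self]; exact ⟨rfl, rfl⟩⟩

/-- The product of `σˣ` over the edges of a chain. -/
noncomputable def chainX : Chain →+ Additive (unitary QuasiLocal) :=
  involutionHom (s := unitaryX) (fun e => Subtype.ext (sigmaX_mul_self e))
    fun e f => Subtype.ext (commute_sigmaX e f)

/-- The product of `σᶻ` over the edges of a chain. -/
noncomputable def chainZ : Chain →+ Additive (unitary QuasiLocal) :=
  involutionHom (s := unitaryZ) (fun e => Subtype.ext (sigmaZ_mul_self e))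
    fun e f => Subtype.ext (commute_sigmaZ e f)

theorem chainX_single (e : Edge) : chainX (Finsupp.single e 1) = .ofMul (unitaryX e) :=
  involutionHom_single _ _ e

theorem chainZ_single (e : Edge) : chainZ (Finsupp.single e 1) = .ofMul (unitaryZ e) :=
  involutionHom_single _ _ e

/-- The Pauli operator with `σˣ` on the edges of `S` and `σᶻ` on the edges of `T`. -/
noncomputable def pauli (S T : Chain) : QuasiLocal :=
  ((chainX S).toMul : QuasiLocal) * ((chainZ T).toMul : QuasiLocal)

theorem pauli_mem_unitary (S T : Chain) : pauli S T ∈ unitary QuasiLocal :=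
  mul_mem (chainX S).toMul.2 (chainZ T).toMul.2

theorem pauli_zero : pauli 0 0 = 1 := by
  simp [pauli]

theorem pauli_add_zero (S S' : Chain) : pauli (S + S') 0 = pauli S 0 * pauli S' 0 := by
  simp [pauli]

theorem pauli_zero_add (T T' : Chain) : pauli 0 (T + T') = pauli 0 T * pauli 0 T' := by
  simp [pauli]

theorem pauli_eq_mul (S T : Chain) : pauli S T = pauli S 0 * pauli 0 T := by
  simp [pauli]

theorem pauli_single_zero (e : Edge) : pauli (Finsupp.single e 1) 0 = sigmaX e := by
  simp [pauli, chainX_single, unitaryX]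

theorem pauli_zero_single (e : Edge) : pauli 0 (Finsupp.single e 1) = sigmaZ e := by
  simp [pauli, chainZ_single, unitaryZ]

theorem pauli_listChain_zero (l : List Edge) : pauli (listChain l) 0 = (l.map sigmaX).prod := by
  induction l with
  | nil => exact pauli_zero
  | cons e l ih =>
    rw [List.map_cons, List.prod_cons, ← ih, ← pauli_single_zero, ← pauli_add_zero]
    rfl

theorem pauli_zero_listChain (l : List Edge) : pauli 0 (listChain l) = (l.map sigmaZ).prod := by
  induction l with
  | nil => exact pauli_zero
  | cons e l ih =>
    rw [List.map_cons, List.prod_cons, ← ih, ← pauli_zero_single, ← pauli_zero_add]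
    rfl

theorem commute_pauli_zero (S S' : Chain) : Commute (pauli S 0) (pauli S' 0) := by
  rw [Commute, SemiconjBy, ← pauli_add_zero, add_comm, pauli_add_zero]

theorem commute_pauli_zero_left (T T' : Chain) : Commute (pauli 0 T) (pauli 0 T') := by
  rw [Commute, SemiconjBy, ← pauli_zero_add, add_comm, pauli_zero_add]

theorem commuteUpToSign_sigmaX_sigmaZ (e f : Edge) :
    CommuteUpToSign ((-1) ^ (Finsupp.single f 1 e : ZMod 2)) (sigmaX e) (sigmaZ f) := by
  rcases eq_or_ne e f with rfl | h
  · rw [Finsupp.single_eq_same, uzpow_one]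
    exact .of_semiconjBy_neg (semiconjBy_sigmaX_sigmaZ e)
  · rw [Finsupp.single_eq_of_ne h, uzpow_zero]
    exact .of_commute (commute_siteOperator h _ _)

theorem commuteUpToSign_pauli_zero (S T : Chain) :
    CommuteUpToSign ((-1) ^ crossing S T) (pauli S 0) (pauli 0 T) := by
  induction S using chain_induction with
  | zero =>
    rw [LinearMap.map_zero₂, uzpow_zero, pauli_zero]
    exact .of_commute (Commute.one_left _)
  | add S S' hS hS' =>
    rw [LinearMap.map_add₂, uzpow_add, pauli_add_zero]
    exact hS.mul_left hS'
  | single e =>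
    rw [crossing_single_left]
    induction T using chain_induction with
    | zero =>
      rw [Finsupp.zero_apply, uzpow_zero, pauli_zero]
      exact .of_commute (Commute.one_right _)
    | add T T' hT hT' =>
      rw [Finsupp.add_apply, uzpow_add, pauli_zero_add]
      exact hT.mul_right hT'
    | single f =>
      rw [pauli_single_zero, pauli_zero_single]
      exact commuteUpToSign_sigmaX_sigmaZ e f

theorem commuteUpToSign_pauli (S T S' T' : Chain) :
    CommuteUpToSign ((-1) ^ (crossing S T' + crossing S' T)) (pauli S T) (pauli S' T') := by
  have hX : CommuteUpToSign (1 * (-1) ^ crossing S T') (pauli S 0) (pauli S' T') := by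
    rw [pauli_eq_mul S' T']
    exact (CommuteUpToSign.of_commute (commute_pauli_zero S S')).mul_right
      (commuteUpToSign_pauli_zero S T')
  have hZ : CommuteUpToSign ((-1) ^ crossing S' T * 1) (pauli 0 T) (pauli S' T') := by
    rw [pauli_eq_mul S' T']
    exact (commuteUpToSign_pauli_zero S' T).symm.mul_right
      (.of_commute (commute_pauli_zero_left T T'))
  rw [uzpow_add, pauli_eq_mul S T]
  simpa only [one_mul, mul_one] using hX.mul_left hZ

theorem pauli_mul_pauli (S T S' T' : Chain) :
    pauli S T * pauli S' T' = (-1 : ℤˣ) ^ crossing S' T • pauli (S + S') (T + T') := by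
  calc pauli S T * pauli S' T' = pauli S 0 * (pauli 0 T * pauli S' 0) * pauli 0 T' := by
        rw [pauli_eq_mul S T, pauli_eq_mul S' T']
        simp only [mul_assoc]
    _ = (-1 : ℤˣ) ^ crossing S' T • (pauli S 0 * (pauli S' 0 * pauli 0 T) * pauli 0 T') := by
        rw [(commuteUpToSign_pauli_zero S' T).symm, mul_smul_comm, smul_mul_assoc]
    _ = _ := by
        rw [pauli_eq_mul (S + S'), pauli_add_zero, pauli_zero_add]
        simp only [mul_assoc]

theorem dense_span_pauli :
    Dense (Submodule.span ℂ (Set.range fun ST : Chain × Chain => pauli ST.1 ST.2) :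
      Set QuasiLocal) := by
  set P := Submodule.span ℂ (Set.range fun ST : Chain × Chain => pauli ST.1 ST.2) with hP
  have hpauli (S T : Chain) : pauli S T ∈ P := Submodule.subset_span ⟨(S, T), rfl⟩
  have hmul : P * P ≤ P := by
    rw [hP, Submodule.span_mul_span, Submodule.span_le]
    rintro _ ⟨_, ⟨⟨S, T⟩, rfl⟩, _, ⟨⟨S', T'⟩, rfl⟩, rfl⟩
    change pauli S T * pauli S' T' ∈ P
    rw [pauli_mul_pauli]
    rcases Int.units_eq_one_or ((-1 : ℤˣ) ^ crossing S' T) with h | h <;> rw [h]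
    · simpa only [one_smul] using hpauli _ _
    · simpa only [Units.neg_smul, one_smul] using neg_mem (hpauli _ _)
  exact dense_of_sigma_mem
    (D := P.toSubalgebra (pauli_zero ▸ hpauli 0 0)
      fun x y hx hy => hmul (Submodule.mul_mem_mul hx hy))
    (fun e => pauli_single_zero e ▸ hpauli _ _) (fun e => pauli_zero_single e ▸ hpauli _ _)

end PauliOperators

/-! ### The toric algebra and its ribbon operators -/

section ToricAlgebra

theorem starOperator_eq_pauli (v : Vertex) : starOperator v = pauli (starChain v) 0 :=
  (pauli_listChain_zero _).symm

theorem faceOperator_eq_pauli (p : Face) : faceOperator p = pauli 0 (faceChain p) :=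
  (pauli_zero_listChain _).symm

theorem commuteUpToSign_starOperator_pauli (v : Vertex) (S T : Chain) :
    CommuteUpToSign ((-1) ^ crossing (starChain v) T) (starOperator v) (pauli S T) := by
  simpa only [starOperator_eq_pauli, map_zero, add_zero]
    using commuteUpToSign_pauli (starChain v) 0 S T

theorem commuteUpToSign_faceOperator_pauli (p : Face) (S T : Chain) :
    CommuteUpToSign ((-1) ^ crossing (faceChain p) S) (faceOperator p) (pauli S T) := by
  simpa only [faceOperator_eq_pauli, LinearMap.map_zero₂, zero_add, crossing_comm S]
    using commuteUpToSign_pauli 0 (faceChain p) S T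

theorem commute_starOperator_faceOperator (v : Vertex) (p : Face) :
    Commute (starOperator v) (faceOperator p) := by
  have h := commuteUpToSign_starOperator_pauli v 0 (faceChain p)
  rw [crossing_starChain_faceChain, uzpow_zero, ← faceOperator_eq_pauli] at h
  exact h.commute

theorem starOperator_mem_toricAlgebra (v : Vertex) : starOperator v ∈ toricAlgebra :=
  subset_generatedCStar _ (.inl ⟨v, rfl⟩)

theorem faceOperator_mem_toricAlgebra (p : Face) : faceOperator p ∈ toricAlgebra :=
  subset_generatedCStar _ (.inr ⟨p, rfl⟩)

theorem pauli_mem_toricAlgebra {S T : Chain} (hS : S ∈ coboundaries) (hT : T ∈ boundaries) :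
    pauli S T ∈ toricAlgebra := by
  have hX : pauli S 0 ∈ toricAlgebra := by
    refine span_chain_induction (p := (pauli · 0 ∈ toricAlgebra)) hS
      (Set.forall_mem_range.2 fun v => ?_) ?_ fun S S' h h' => ?_
    · exact starOperator_eq_pauli v ▸ starOperator_mem_toricAlgebra v
    · exact pauli_zero ▸ one_mem toricAlgebra
    · exact pauli_add_zero S S' ▸ mul_mem h h'
  have hZ : pauli 0 T ∈ toricAlgebra := by
    refine span_chain_induction (p := (pauli 0 · ∈ toricAlgebra)) hT
      (Set.forall_mem_range.2 fun p => ?_) ?_ fun T T' h h' => ?_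
    · exact faceOperator_eq_pauli p ▸ faceOperator_mem_toricAlgebra p
    · exact pauli_zero ▸ one_mem toricAlgebra
    · exact pauli_zero_add T T' ▸ mul_mem h h'
  exact pauli_eq_mul S T ▸ mul_mem hX hZ

theorem pauli_mem_toricAlgebra_or_exists_semiconjBy_neg (S T : Chain) :
    pauli S T ∈ toricAlgebra ∨ ∃ g ∈ Set.range starOperator ∪ Set.range faceOperator,
      SemiconjBy g (pauli S T) (-pauli S T) := by
  have eq_one {c : ZMod 2} (hc : c ≠ 0) : c = 1 := Fin.eq_one_of_ne_zero _ hc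
  by_cases hT : ∀ v, crossing (starChain v) T = 0
  · by_cases hS : ∀ p, crossing (faceChain p) S = 0
    · exact .inl (pauli_mem_toricAlgebra (mem_coboundaries hS) (mem_boundaries hT))
    · obtain ⟨p, hp⟩ := not_forall.1 hS
      have h := commuteUpToSign_faceOperator_pauli p S T
      rw [eq_one hp, uzpow_one] at h
      exact .inr ⟨_, .inr ⟨p, rfl⟩, h.semiconjBy_neg⟩
  · obtain ⟨v, hv⟩ := not_forall.1 hT
    have h := commuteUpToSign_starOperator_pauli v S T
    rw [eq_one hv, uzpow_one] at h
    exact .inr ⟨_, .inl ⟨v, rfl⟩, h.semiconjBy_neg⟩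

theorem isMasa_toricAlgebra : IsMasa toricAlgebra := by
  refine isMasa_generatedCStar ?_ ?_ dense_span_pauli ?_ ?_
  · rintro _ (⟨v, rfl⟩ | ⟨p, rfl⟩)
    · exact starOperator_eq_pauli v ▸ pauli_mem_unitary _ _
    · exact faceOperator_eq_pauli p ▸ pauli_mem_unitary _ _
  · rintro _ (⟨v, rfl⟩ | ⟨p, rfl⟩) _ (⟨w, rfl⟩ | ⟨q, rfl⟩)
    · simpa only [starOperator_eq_pauli] using commute_pauli_zero _ _
    · exact commute_starOperator_faceOperator v q
    · exact (commute_starOperator_faceOperator w p).symm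
    · simpa only [faceOperator_eq_pauli] using commute_pauli_zero_left _ _
  · rintro _ (⟨v, rfl⟩ | ⟨p, rfl⟩) _ ⟨⟨S, T⟩, rfl⟩
    · exact (commuteUpToSign_starOperator_pauli v S T).commute_or_semiconjBy_neg
    · exact (commuteUpToSign_faceOperator_pauli p S T).commute_or_semiconjBy_neg
  · rintro _ ⟨⟨S, T⟩, rfl⟩
    exact pauli_mem_toricAlgebra_or_exists_semiconjBy_neg S T

theorem isNormalizer_pauli (S T : Chain) : IsNormalizer toricAlgebra (pauli S T) := by
  refine isNormalizer_generatedCStar (pauli_mem_unitary S T) ?_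
  rintro _ (⟨v, rfl⟩ | ⟨p, rfl⟩)
  · rw [starOperator_eq_pauli]
    exact (commuteUpToSign_pauli _ _ _ _).commute_or_semiconjBy_neg
  · rw [faceOperator_eq_pauli]
    exact (commuteUpToSign_pauli _ _ _ _).commute_or_semiconjBy_neg

end ToricAlgebra

section Ribbons

theorem isNormalizer_ribbonZ (ρ : OpenPath endVertices) :
    IsNormalizer toricAlgebra (ribbonZ ρ) := by
  rw [ribbonZ, ← Function.comp_def, ← List.map_ofFn, ← pauli_zero_listChain]
  exact isNormalizer_pauli _ _

theorem isNormalizer_ribbonX (ρ : OpenPath sideFaces) :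
    IsNormalizer toricAlgebra (ribbonX ρ) := by
  rw [ribbonX, ← Function.comp_def, ← List.map_ofFn, ← pauli_listChain_zero]
  exact isNormalizer_pauli _ _

/-- The path that consists of a single edge. -/
def OpenPath.single {W : Type} {ends : Edge → Sym2 W} {e : Edge} {a b : W} (hab : a ≠ b)
    (he : ends e = s(a, b)) : OpenPath ends where
  length := 1
  length_pos := one_pos
  vertex := ![a, b]
  edge := ![e]
  injective := by simpa [Function.Injective, Fin.forall_fin_two] using ⟨hab, hab.symm⟩
  joins i := by
    obtain rfl := Subsingleton.elim i 0
    exact he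

theorem exists_endVertices_eq (e : Edge) : ∃ a b, a ≠ b ∧ endVertices e = s(a, b) := by
  obtain ⟨⟨x, y⟩, _ | _⟩ := e <;> exact ⟨_, _, by simp, rfl⟩

theorem exists_sideFaces_eq (e : Edge) : ∃ a b, a ≠ b ∧ sideFaces e = s(a, b) := by
  obtain ⟨⟨x, y⟩, _ | _⟩ := e <;> exact ⟨_, _, by simp, rfl⟩

theorem sigmaZ_mem_ribbonOperators (e : Edge) : sigmaZ e ∈ ribbonOperators := by
  obtain ⟨a, b, hab, he⟩ := exists_endVertices_eq e
  exact .inl ⟨.single hab he, by simp [ribbonZ, OpenPath.single]⟩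

theorem sigmaX_mem_ribbonOperators (e : Edge) : sigmaX e ∈ ribbonOperators := by
  obtain ⟨a, b, hab, he⟩ := exists_sideFaces_eq e
  exact .inr ⟨.single hab he, by simp [ribbonX, OpenPath.single]⟩

theorem generatedCStar_ribbonOperators : generatedCStar ribbonOperators = ⊤ :=
  generatedCStar_eq_top_of_dense <|
    dense_of_sigma_mem (D := (generatedCStar ribbonOperators).toSubalgebra)
      (fun e => subset_generatedCStar _ (sigmaX_mem_ribbonOperators e))
      fun e => subset_generatedCStar _ (sigmaZ_mem_ribbonOperators e)

end Ribbons

end ToricCode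

theorem proposition3p2 :
    ToricCode.IsRegularMasa ToricCode.toricAlgebra ∧
      (∀ a ∈ ToricCode.ribbonOperators, ToricCode.IsNormalizer ToricCode.toricAlgebra a) ∧
      ToricCode.generatedCStar ToricCode.ribbonOperators = ⊤ := by
  have hnorm : ∀ a ∈ ToricCode.ribbonOperators,
      ToricCode.IsNormalizer ToricCode.toricAlgebra a := by
    rintro _ (⟨ρ, rfl⟩ | ⟨ρ, rfl⟩)
    exacts [ToricCode.isNormalizer_ribbonZ ρ, ToricCode.isNormalizer_ribbonX ρ]
  have hgen := ToricCode.generatedCStar_ribbonOperators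
  refine ⟨⟨ToricCode.isMasa_toricAlgebra, top_le_iff.1 ?_⟩, hnorm, hgen⟩
  exact hgen ▸ ToricCode.generatedCStar_mono hnorm
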